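/- Let $G$ be a finite nilpotent group. If there exists an odd prime $p$ such that the $p$-primary part of $G$ (that is, its unique Sylow $p$-subgroup) is non-Abelian, then $G$ does not have multiplicity-free tensor products. Here a finite group $G$ is said to have multiplicity-free tensor products if, for all irreducible complex representations $U$ and $V$ of $G$, the representation $U \otimes V$ of $G$ has a multiplicity-free decomposition into irreducible representations, i.e. is a direct sum of finitely many irreducible representations that are pairwise non-isomorphic. -/

import Mathlib

open scoped TensorProduct

/-- A representation is multiplicity-free if it has a multiplicity-free decomposition into
irreducible representations: it is the (internal) direct sum of finitely many irreducible
subrepresentations no two of which are isomorphic. -/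
def IsMultiplicityFreeRep {G V : Type*} [Group G] [AddCommGroup V] [Module ℂ V]
    (ρ : Representation ℂ G V) : Prop :=
  ∃ (n : ℕ) (W : Fin n → Subrepresentation ρ),
    DirectSum.IsInternal (fun i => (W i).toSubmodule) ∧
    (∀ i, (W i).toRepresentation.IsIrreducible) ∧
    ∀ i j, i ≠ j →
      IsEmpty (Representation.Equiv (W i).toRepresentation (W j).toRepresentation)

/-- A finite group `G` has multiplicity-free tensor products if `U ⊗ V` is multiplicity-free for
all irreducible complex representations `U` and `V` of `G`.  (An irreducible representation of a
finite group is finite-dimensional, hence isomorphic to one on some `ℂⁿ`, so spaces in `Type`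
account for all isomorphism classes, whatever the universe of `G`.) -/
def HasMultiplicityFreeTensorProducts (G : Type*) [Group G] : Prop :=
  ∀ (U V : Type) [AddCommGroup U] [Module ℂ U] [AddCommGroup V] [Module ℂ V]
    (ρ : Representation ℂ G U) (σ : Representation ℂ G V),
    ρ.IsIrreducible → σ.IsIrreducible → IsMultiplicityFreeRep (ρ.tprod σ)

/-! A nonabelian Sylow `p`-subgroup is a direct factor of `G`, and killing the third term of its
lower central series leaves a class-two quotient `Q` with a commutator `z = ⁅x, y⁆ ≠ 1` of odd
order. In an irreducible `ρ` of `Q` with `ρ z ≠ 1`, the central `z` acts by a scalar `a`. The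
operators `ρ g ⊗ ρ g⁻¹` intertwine the diagonal action on `U ⊗ U`, and those for `x` and `y` commute
up to `ρ z ⊗ ρ z = a ^ 2`. By Schur, multiplicity-freeness makes all intertwiners commute, so `a ^ 2
= 1`; odd order then forces `a = 1`, a contradiction. -/

open scoped TensorProduct commutatorElement

namespace Representation

section ofModule'

variable {k G M : Type*} [Field k] [Group G] [AddCommGroup M] [Module k M]
  [Module (MonoidAlgebra k G) M] [IsScalarTower k (MonoidAlgebra k G) M]

theorem ofModule'_apply (g : G) (m : M) :
    ofModule' (k := k) (G := G) M g m = MonoidAlgebra.of k G g • m :=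
  rfl

variable (M) in
theorem isIrreducible_ofModule' [hM : IsSimpleModule (MonoidAlgebra k G) M] :
    IsIrreducible (ofModule' (k := k) (G := G) M) := by
  let e : Submodule (MonoidAlgebra k G) M ≃o Subrepresentation (ofModule' (k := k) (G := G) M) :=
    { toFun := fun N => ⟨N.restrictScalars k, fun g _ hv => N.smul_mem (MonoidAlgebra.of k G g) hv⟩
      invFun := fun N =>
        { N.toSubmodule with
          smul_mem' := fun c m hm => by
            induction c using MonoidAlgebra.induction_on with
            | of g => exact N.apply_mem_toSubmodule g hm
            | add a b ha hb => rw [add_smul]; exact N.toSubmodule.add_mem ha hb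
            | smul r a ha => rw [smul_assoc]; exact N.toSubmodule.smul_mem r ha }
      left_inv := fun _ => rfl
      right_inv := fun _ => rfl
      map_rel_iff' := Iff.rfl }
  exact e.isSimpleOrder_iff.mp (isSimpleModule_iff _ _ |>.mp hM)

end ofModule'

/-- A nontrivial element of a finite group acts nontrivially in some irreducible complex
representation. -/
theorem exists_isIrreducible_apply_ne_one {Q : Type} [Group Q] [Finite Q] {z : Q} (hz : z ≠ 1) :
    ∃ (U : Type) (_ : AddCommGroup U) (_ : Module ℂ U) (_ : FiniteDimensional ℂ U)
      (ρ : Representation ℂ Q U), ρ.IsIrreducible ∧ ρ z ≠ 1 := by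
  by_contra! hcon
  -- By Maschke the group algebra is a sum of simple left ideals; if `z` fixes each of them
  -- pointwise, it fixes `1`.
  have key : ∀ S : Submodule (MonoidAlgebra ℂ Q) (MonoidAlgebra ℂ Q),
      IsSimpleModule (MonoidAlgebra ℂ Q) S → ∀ s ∈ S, MonoidAlgebra.of ℂ Q z * s = s := by
    intro S hS s hs
    have hfin : FiniteDimensional ℂ S := Module.Finite.trans (MonoidAlgebra ℂ Q) S
    have h1 := hcon S _ _ hfin (ofModule' S) (isIrreducible_ofModule' S)
    exact congrArg Subtype.val ((ofModule'_apply _ _).symm.trans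
      (LinearMap.congr_fun h1 (⟨s, hs⟩ : S)))
  have hfix : ∀ m : MonoidAlgebra ℂ Q, MonoidAlgebra.of ℂ Q z * m = m := by
    intro m
    have hm : m ∈ sSup {S : Submodule (MonoidAlgebra ℂ Q) (MonoidAlgebra ℂ Q) |
        IsSimpleModule (MonoidAlgebra ℂ Q) S} := by
      rw [IsSemisimpleModule.sSup_simples_eq_top]; trivial
    rw [sSup_eq_iSup'] at hm
    induction hm using Submodule.iSup_induction' with
    | mem S s hs => exact key S S.2 s hs
    | zero => exact mul_zero _
    | add a b _ _ ha hb => rw [mul_add, ha, hb]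
  have h1 := hfix 1
  rw [mul_one, ← map_one (MonoidAlgebra.of ℂ Q)] at h1
  exact hz (MonoidAlgebra.of_injective h1)

/-- The pullback of an irreducible representation along a surjective homomorphism is
irreducible. -/
theorem IsIrreducible.comp_of_surjective {k G Q U : Type*} [Field k] [Group G] [Group Q]
    [AddCommGroup U] [Module k U] {ρ : Representation k Q U} (hρ : ρ.IsIrreducible)
    {φ : G →* Q} (hφ : Function.Surjective φ) :
    IsIrreducible (ρ.comp φ : Representation k G U) := by
  let e : Subrepresentation ρ ≃o Subrepresentation (ρ.comp φ : Representation k G U) :=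
    { toFun := fun N => ⟨N.toSubmodule, fun g v hv => N.apply_mem_toSubmodule (φ g) hv⟩
      invFun := fun N => ⟨N.toSubmodule, fun q v hv => by
        obtain ⟨g, rfl⟩ := hφ q
        exact N.apply_mem_toSubmodule g hv⟩
      left_inv := fun _ => rfl
      right_inv := fun _ => rfl
      map_rel_iff' := Iff.rfl }
  exact e.isSimpleOrder_iff.mp hρ

/-- A central element acts as a scalar in a finite-dimensional irreducible representation. -/
theorem IsIrreducible.exists_eq_smul_one_of_mem_center {k Q U : Type*} [Field k] [IsAlgClosed k]
    [Group Q] [AddCommGroup U] [Module k U] [FiniteDimensional k U] {ρ : Representation k Q U}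
    (hρ : ρ.IsIrreducible) {z : Q} (hz : z ∈ Subgroup.center Q) : ∃ a : k, ρ z = a • 1 := by
  obtain ⟨a, ha⟩ := hρ.algebraMap_intertwiningMap_bijective_of_isAlgClosed.2
    (⟨ρ z, fun g => by
      rw [← Module.End.mul_eq_comp, ← Module.End.mul_eq_comp, ← map_mul, ← map_mul,
        Subgroup.mem_center_iff.mp hz g]⟩ : IntertwiningMap ρ ρ)
  exact ⟨a, (congrArg IntertwiningMap.toLinearMap ha).symm⟩

end Representation

open Representation in
/-- The intertwining endomorphisms of a finite-dimensional multiplicity-free representation act on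
each irreducible constituent by scalars, hence commute. -/
theorem IsMultiplicityFreeRep.commute {G V : Type*} [Group G] [AddCommGroup V] [Module ℂ V]
    [FiniteDimensional ℂ V] {ρ : Representation ℂ G V} (h : IsMultiplicityFreeRep ρ)
    {S T : Module.End ℂ V} (hS : ∀ g, Commute S (ρ g)) (hT : ∀ g, Commute T (ρ g)) :
    Commute S T := by
  classical
  obtain ⟨n, W, hW, hirr, hne⟩ := h
  let e : _ ≃ₗ[ℂ] V :=
    LinearEquiv.ofBijective (DirectSum.coeLinearMap fun i => (W i).toSubmodule)
      (show Function.Bijective _ from hW)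
  let π : ∀ i, V →ₗ[ℂ] (W i).toSubmodule := fun i =>
    DirectSum.component ℂ _ (fun i => (W i).toSubmodule) i ∘ₗ e.symm
  have hsum : ∀ v, ∑ i, (π i v : V) = v := by
    intro v
    obtain ⟨d, rfl⟩ := e.surjective v
    simp only [π, LinearMap.comp_apply, LinearEquiv.coe_coe, e.symm_apply_apply]
    change _ = DirectSum.coeLinearMap (fun i => (W i).toSubmodule) d
    rw [DirectSum.coeLinearMap_eq_dfinsuppSum, DFinsupp.sum_eq_sum_fintype _ (fun _ => rfl)]
    rfl
  have he : ∀ i (w : (W i).toSubmodule),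
      e.symm w = DirectSum.lof ℂ _ (fun i => (W i).toSubmodule) i w := by
    intro i w
    rw [LinearEquiv.symm_apply_eq]
    exact (DirectSum.coeLinearMap_lof (fun i => (W i).toSubmodule) i w).symm
  have hπ_self : ∀ i (w : (W i).toSubmodule), π i w = w := by
    intro i w
    simp only [π, LinearMap.comp_apply, LinearEquiv.coe_coe, he]
    exact DirectSum.component.lof_self _ _ _
  have hπ_ne : ∀ i j (w : (W i).toSubmodule), i ≠ j → π j w = 0 := by
    intro i j w hij
    simp only [π, LinearMap.comp_apply, LinearEquiv.coe_coe, he]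
    exact (DirectSum.component.of _ _ _ _).trans (dif_neg hij)
  have hπρ : ∀ j g v, π j (ρ g v) = (W j).toRepresentation g (π j v) := by
    intro j g v
    conv_lhs => rw [← hsum v, map_sum, map_sum]
    rw [Finset.sum_eq_single j]
    · exact hπ_self j ((W j).toRepresentation g (π j v))
    · exact fun i _ hij => hπ_ne i j ((W i).toRepresentation g (π i v)) hij
    · simp
  have scal : ∀ R : Module.End ℂ V, (∀ g, Commute R (ρ g)) →
      ∀ i, ∃ c : ℂ, ∀ w ∈ (W i).toSubmodule, R w = c • w := by
    intro R hR i
    have := hirr i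
    -- The block of `R` from `W i` to `W j`: zero off the diagonal and scalar on it, by Schur.
    let f : ∀ j, IntertwiningMap (W i).toRepresentation (W j).toRepresentation := fun j =>
      ⟨π j ∘ₗ R ∘ₗ (W i).toSubmodule.subtype, fun g => by
        ext1 w
        have h1 := LinearMap.congr_fun (hR g) (w : V)
        simp only [Module.End.mul_apply] at h1
        change π j (R (ρ g w)) = _
        rw [h1, hπρ]; rfl⟩
    have hf : ∀ j, j ≠ i → f j = 0 := by
      intro j hj
      have := hirr j
      have := hne i j hj.symm
      exact Subsingleton.elim _ _
    obtain ⟨c, hc⟩ := (hirr i).algebraMap_intertwiningMap_bijective_of_isAlgClosed.2 (f i)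
    refine ⟨c, fun w hw => ?_⟩
    rw [← hsum (R w), Finset.sum_eq_single i]
    · have h2 : f i ⟨w, hw⟩ = c • (⟨w, hw⟩ : (W i).toSubmodule) := by rw [← hc]; rfl
      exact congrArg Subtype.val h2
    · intro j _ hj
      have h2 : f j ⟨w, hw⟩ = 0 := by rw [hf j hj]; rfl
      exact congrArg Subtype.val h2
    · simp
  choose s hs using scal S hS
  choose t ht using scal T hT
  refine LinearMap.ext fun v => ?_
  rw [← hsum v, map_sum, map_sum]
  refine Finset.sum_congr rfl fun i _ => ?_
  simp only [Module.End.mul_apply, ht i _ (π i v).2, hs i _ (π i v).2, map_smul, smul_smul,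
    mul_comm]

/-- A finite group with a quotient of nilpotency class two that contains a nontrivial commutator
of odd order does not have multiplicity-free tensor products. -/
theorem not_hasMultiplicityFreeTensorProducts_of_surjective {G : Type*} [Group G] {Q : Type}
    [Group Q] [Finite Q] {φ : G →* Q} (hφ : Function.Surjective φ)
    (hc : ∀ a b : Q, ⁅a, b⁆ ∈ Subgroup.center Q) {x y : Q} (hxy : ⁅x, y⁆ ≠ 1)
    (hodd : Odd (orderOf ⁅x, y⁆)) : ¬ HasMultiplicityFreeTensorProducts G := by
  intro hG
  obtain ⟨U, _, _, _, ρ, hρ, hz⟩ := Representation.exists_isIrreducible_apply_ne_one hxy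
  have hρ' := hρ.comp_of_surjective hφ
  have hmf := hG U U _ _ hρ' hρ'
  let M (a b : Q) : Module.End ℂ (U ⊗[ℂ] U) := TensorProduct.map (ρ a) (ρ b)
  have hM : ∀ a b c d, M a b * M c d = M (a * c) (b * d) := by
    intro a b c d; simp only [M, map_mul, TensorProduct.map_mul]
  -- The scalars of `z` and `z⁻¹` cancel across the tensor product.
  have hinv : ∀ z ∈ Subgroup.center Q, ∀ u v, M (z * u) (z⁻¹ * v) = M u v := by
    intro z hz u v
    obtain ⟨a, ha⟩ := hρ.exists_eq_smul_one_of_mem_center hz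
    obtain ⟨b, hb⟩ := hρ.exists_eq_smul_one_of_mem_center (inv_mem hz)
    have hab : (a * b) • (1 : Module.End ℂ U) = 1 := by
      rw [← mul_one (1 : Module.End ℂ U), ← smul_mul_smul_comm, ← ha, ← hb, ← map_mul,
        mul_inv_cancel, map_one, mul_one]
    have : M (z * u) (z⁻¹ * v) = (a * b) • M u v := by
      simp only [M, map_mul, ha, hb, smul_mul_assoc, one_mul, TensorProduct.map_smul_left,
        TensorProduct.map_smul_right, smul_smul, mul_comm]
    rw [this]
    simp only [M]
    rw [← TensorProduct.map_smul_left, ← one_mul (ρ u), ← smul_mul_assoc, hab, one_mul]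
  have hcomm : ∀ a g, Commute (M a a⁻¹) ((Representation.tprod (ρ.comp φ) (ρ.comp φ)) g) := by
    intro a g
    change M a a⁻¹ * M (φ g) (φ g) = M (φ g) (φ g) * M a a⁻¹
    -- Moving `φ g` past `a` costs `⁅φ g, a⁆`; moving it past `a⁻¹` costs the inverse, as
    -- commutators are central.
    have hz' := Subgroup.mem_center_iff.mp (inv_mem (hc (φ g) a)) a⁻¹
    rw [hM, hM, ← hinv _ (hc (φ g) a), ← mul_assoc _ a⁻¹, ← hz']
    congr 1 <;> simp only [commutatorElement_def] <;> group
  have hST := hmf.commute (hcomm x) (hcomm y)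
  obtain ⟨a, ha⟩ := hρ.exists_eq_smul_one_of_mem_center (hc x y)
  have hnt : Nontrivial U := by
    by_contra hU
    rw [not_nontrivial_iff_subsingleton] at hU
    exact hz (Subsingleton.elim _ _)
  have hinv' : ∀ b c, IsUnit (M b c) := fun b c =>
    ⟨⟨M b c, M b⁻¹ c⁻¹, by rw [hM]; simp [M], by rw [hM]; simp [M]⟩, rfl⟩
  have hcc : M ⁅x, y⁆ ⁅x, y⁆ = 1 := by
    have h1 : M ⁅x, y⁆ ⁅x, y⁆ * (M y y⁻¹ * M x x⁻¹) = M x x⁻¹ * M y y⁻¹ := by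
      rw [hM, hM, hM, ← Subgroup.mem_center_iff.mp (hc x y) (y⁻¹ * x⁻¹)]
      congr 1 <;> simp only [commutatorElement_def] <;> group
    exact ((hinv' _ _).mul (hinv' _ _)).mul_right_cancel
      (h1.trans (hST.eq.trans (one_mul _).symm))
  have ha2 : a ^ 2 = 1 := by
    have h1 : (a ^ 2) • (1 : Module.End ℂ (U ⊗[ℂ] U)) = (1 : ℂ) • 1 := by
      rw [one_smul]; nth_rw 2 [← hcc]
      simp only [M, ha, TensorProduct.map_smul_left, TensorProduct.map_smul_right, smul_smul,
        TensorProduct.map_one, sq]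
    exact smul_left_injective ℂ (one_ne_zero (α := Module.End ℂ (U ⊗[ℂ] U))) h1
  have hapow : a ^ orderOf ⁅x, y⁆ = 1 := by
    have h1 : (a ^ orderOf ⁅x, y⁆) • (1 : Module.End ℂ U) = (1 : ℂ) • 1 := by
      rw [one_smul, ← one_pow (orderOf ⁅x, y⁆), ← smul_pow, ← ha, ← map_pow,
        pow_orderOf_eq_one, map_one, one_pow]
    exact smul_left_injective ℂ (one_ne_zero (α := Module.End ℂ _)) h1
  have ha1 : a = 1 := by
    rw [← orderOf_eq_one_iff]
    exact Nat.eq_one_of_dvd_coprimes (Nat.coprime_two_left.mpr hodd)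
      (orderOf_dvd_of_pow_eq_one ha2) (orderOf_dvd_of_pow_eq_one hapow)
  exact hz (by rw [ha, ha1, one_smul])

/-- In a nonabelian nilpotent group, some commutator lies outside the third term of the lower
central series. -/
theorem exists_commutator_notMem {P : Type*} [Group P] [Group.IsNilpotent P] {x y : P}
    (hxy : x * y ≠ y * x) : ∃ a b : P, ⁅a, b⁆ ∉ (⊤ : Subgroup P).lowerCentralSeries 2 := by
  by_contra! h
  -- Indices start at `0`, so the hypothesis gives term `1` ≤ term `2`; the series then stalls and
  -- cannot reach `⊥` unless term `1` is trivial.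
  have h12 : ∀ n, (⊤ : Subgroup P).lowerCentralSeries 1 ≤ (⊤ : Subgroup P).lowerCentralSeries (n + 1) := by
    intro n
    induction n with
    | zero => exact le_rfl
    | succ n ih =>
      refine le_trans (b := (⊤ : Subgroup P).lowerCentralSeries 2) ?_ ?_
      · rw [Subgroup.lowerCentralSeries_succ, Subgroup.commutator_le]
        exact fun a _ b _ => h a b
      · exact Subgroup.commutator_mono ih le_rfl
  obtain ⟨n, hn⟩ := Subgroup.nilpotent_iff_lowerCentralSeries.mp ‹Group.IsNilpotent P›
  have h1 : ⁅x, y⁆ ∈ (⊤ : Subgroup P).lowerCentralSeries n :=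
    Subgroup.lowerCentralSeries_antitone _ n.le_succ
      (h12 n (Subgroup.commutator_mem_commutator (Subgroup.mem_top x) (Subgroup.mem_top y)))
  rw [hn, Subgroup.mem_bot, commutatorElement_eq_one_iff_mul_comm] at h1
  exact hxy h1

theorem mainTheorem12 {G : Type*} [Group G] [Finite G] [Group.IsNilpotent G]
    (h : ∃ p : ℕ, p.Prime ∧ Odd p ∧ ∃ P : Sylow p G, ∃ x ∈ P, ∃ y ∈ P, x * y ≠ y * x) :
    ¬ HasMultiplicityFreeTensorProducts G := by
  obtain ⟨p, hp, hodd, P, x, hx, y, hy, hxy⟩ := h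
  have := Fact.mk hp
  have hpG : p ∈ (Nat.card G).primeFactors := by
    have : Nontrivial P := ⟨⟨x, hx⟩, 1, fun h1 => hxy (by
      rw [show x = 1 from congrArg Subtype.val h1, one_mul, mul_one])⟩
    obtain ⟨n, hn⟩ := IsPGroup.iff_card.mp P.isPGroup'
    have hn0 : n ≠ 0 := by
      rintro rfl
      exact (Finite.one_lt_card (α := P)).ne' (by simpa using hn)
    exact Nat.mem_primeFactors.mpr ⟨hp, (dvd_pow_self p hn0).trans
      (hn ▸ Subgroup.card_subgroup_dvd_card (P : Subgroup G)), Nat.card_pos.ne'⟩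
  obtain ⟨e⟩ := (Group.isNilpotent_of_finite_tfae.out 0 4 rfl rfl).mp ‹Group.IsNilpotent G›
  let π : G →* P := ((Pi.evalMonoidHom (fun P : Sylow p G => (P : Subgroup G)) P).comp
    (Pi.evalMonoidHom (fun p : (Nat.card G).primeFactors => ∀ P : Sylow p G, (P : Subgroup G))
      ⟨p, hpG⟩)).comp e.symm.toMonoidHom
  have hπ : Function.Surjective π :=
    ((Function.surjective_eval (β := fun P : Sylow p G => (P : Subgroup G)) P).comp
      (Function.surjective_eval (β := fun p : (Nat.card G).primeFactors =>
        ∀ P : Sylow p G, (P : Subgroup G)) ⟨p, hpG⟩)).comp e.symm.surjective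
  have := P.isPGroup'.isNilpotent
  obtain ⟨a, b, hab⟩ := exists_commutator_notMem (P := P) (x := ⟨x, hx⟩) (y := ⟨y, hy⟩)
    (fun h => hxy (congrArg Subtype.val h))
  let K := (⊤ : Subgroup P).lowerCentralSeries 2
  -- The test representations live in `Type`, so the finite quotient is moved there from the
  -- universe of `G`.
  let ε : (P ⧸ K) ≃* Shrink.{0} (P ⧸ K) := Shrink.mulEquiv.symm
  refine not_hasMultiplicityFreeTensorProducts_of_surjective
    (φ := (ε.toMonoidHom.comp (QuotientGroup.mk' K)).comp π)
    ((ε.surjective.comp (QuotientGroup.mk'_surjective K)).comp hπ) ?_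
    (x := ε (QuotientGroup.mk' K a)) (y := ε (QuotientGroup.mk' K b)) ?_ ?_
  · intro u v
    obtain ⟨u, rfl⟩ := (ε.surjective.comp (QuotientGroup.mk'_surjective K)) u
    obtain ⟨v, rfl⟩ := (ε.surjective.comp (QuotientGroup.mk'_surjective K)) v
    refine Subgroup.mem_center_iff.mpr fun w => ?_
    obtain ⟨w, rfl⟩ := (ε.surjective.comp (QuotientGroup.mk'_surjective K)) w
    simp only [Function.comp_apply]
    rw [← map_commutatorElement, ← map_commutatorElement, eq_comm,
      ← commutatorElement_eq_one_iff_mul_comm, ← map_commutatorElement, ← map_commutatorElement,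
      map_eq_one_iff ε ε.injective]
    exact (QuotientGroup.eq_one_iff _).mpr
      (Subgroup.commutator_mem_commutator
        (Subgroup.commutator_mem_commutator (Subgroup.mem_top u) (Subgroup.mem_top v))
        (Subgroup.mem_top w))
  · rw [← map_commutatorElement, ← map_commutatorElement, Ne, map_eq_one_iff ε ε.injective]
    exact fun h => hab ((QuotientGroup.eq_one_iff _).mp h)
  · rw [← map_commutatorElement, ← map_commutatorElement]
    obtain ⟨k, hk⟩ := P.isPGroup' ⁅a, b⁆
    refine Odd.of_dvd_nat (hodd.pow (n := k)) (orderOf_dvd_of_pow_eq_one ?_)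
    rw [← map_pow, ← map_pow, hk, map_one, map_one]
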